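/- Let $\psi:\mathbb Z\to[0,1)$ satisfy $\sum_{x\in\mathbb Z}\psi(x)<\infty$, let $(V_x)_{x\in\mathbb Z}$ be independent Bernoulli random variables with parameters $(\psi(x))_{x\in\mathbb Z}$, and let $\mathrm{Supp}(V)=\{x\in\mathbb Z: V_x=1\}$. The Bernoulli net with kernel $\psi$ is obtained from i.i.d. random nonempty finite sets $\mathcal A(x,t)\subset\mathbb Z$, $(x,t)\in\mathbb Z^2$, with common law $\mu(A)=\mathbb P(\mathrm{Supp}(V)=A\mid \mathrm{Supp}(V)\neq\emptyset)$, by drawing, for each $(x,t)\in\mathbb Z^2$ and $y\in\mathcal A(x,t)$, an arrow from $(x,t)$ to $(x+y,t+1)$. A path with starting time $\sigma\in\mathbb Z\cup\{-\infty\}$ is a $\mathbb Z$-valued function $\pi$ on the integer times $t\ge\sigma$ that follows the arrows, that is, $\pi(t+1)-\pi(t)\in\mathcal A(\pi(t),t)$ for all integers $t\geq\sigma$. The net is irreducible if every $y\in\mathbb Z$ is reached with positive probability by paths started at position $0$ at time $0$; it is aperiodic if the set of times at which $0$ is reached with positive probability by paths started at position $0$ at time $0$ has greatest common divisor $1$.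 Assume that the Bernoulli net with kernel $\psi$ is irreducible and aperiodic. Then for each $t\in\mathbb Z$ its backbone $$\tilde\xi^*_t:=\{\pi(t):\ \pi \text{ is a path with starting time } -\infty\}$$ is a Bernoulli subset of $\mathbb Z$ with constant intensity $\rho:=1-\prod_{x\in\mathbb Z}(1-\psi(x))$: it is a random subset of $\mathbb Z$ that contains each $x\in\mathbb Z$ independently with probability $\rho$. -/

import Mathlib

open MeasureTheory ProbabilityTheory

noncomputable section

namespace BernoulliNet

/-- The Bernoulli distribution with parameter `p ∈ [0, 1]`, as a measure on truth values:
`True` has probability `p` and `False` has probability `1 - p`. -/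
def bernoulliProp (p : ℝ) : Measure Prop :=
  ENNReal.ofReal p • Measure.dirac True + ENNReal.ofReal (1 - p) • Measure.dirac False

/-- The law of a Bernoulli subset of `ℤ` with intensity `α : ℤ → [0, 1]`: the law of the random
set that contains each `x`, independently of the others, with probability `α x`. -/
def bernoulliSetLaw (α : ℤ → ℝ) : Measure (Set ℤ) :=
  (Measure.infinitePi fun x : ℤ => bernoulliProp (α x)).map
    fun v : ℤ → Prop => {x : ℤ | v x}

/-- `Λ` is a Bernoulli subset of `ℤ` with intensity `α`, under the probability measure `P`. -/
def IsBernoulliSubset {Ω : Type*} [MeasurableSpace Ω] (P : Measure Ω) (Λ : Ω → Set ℤ)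
    (α : ℤ → ℝ) : Prop :=
  HasLaw Λ (bernoulliSetLaw α) P

/-- The offspring law of the kernel `ψ`: the law of `Supp V` conditioned on `Supp V ≠ ∅`, where
`Supp V` is the support of independent Bernoulli variables with parameters `ψ x`. For summable
`ψ` it is carried by the (countable) collection of nonempty finite subsets of `ℤ`. -/
def offspringLaw (ψ : ℤ → ℝ) : Measure (Set ℤ) :=
  ProbabilityTheory.cond (bernoulliSetLaw ψ) {A : Set ℤ | A ≠ ∅}

/-- `𝒜` is a field of i.i.d. random nonempty finite subsets of `ℤ`, indexed by the space-time
points `(x, t)`, whose common law is the offspring law of `ψ`. For each `y ∈ 𝒜 (x, t) ω` there is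
an arrow from `(x, t)` to `(x + y, t + 1)`; these arrows form the Bernoulli net with kernel `ψ`. -/
structure IsBernoulliNet {Ω : Type*} [MeasurableSpace Ω] (P : Measure Ω) (ψ : ℤ → ℝ)
    (𝒜 : ℤ × ℤ → Ω → Set ℤ) : Prop where
  finite : ∀ z ω, (𝒜 z ω).Finite
  nonempty : ∀ z ω, (𝒜 z ω).Nonempty
  hasLaw : ∀ z, HasLaw (𝒜 z) (offspringLaw ψ) P
  indep : iIndepFun 𝒜 P

/-- The paths with starting time `σ ∈ ℤ ∪ {-∞}` that follow the arrows of the configuration `a`,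
given by their positions at integer times. Only the positions at times `t ≥ σ` are meaningful:
those at earlier times are unconstrained. -/
def paths (a : ℤ × ℤ → Set ℤ) (σ : WithBot ℤ) : Set (ℤ → ℤ) :=
  {π | ∀ t : ℤ, σ ≤ (t : WithBot ℤ) → π (t + 1) - π t ∈ a (π t, t)}

/-- The paths that start from the space-time point `(x, s)` and follow the arrows of `a`. -/
def pathsFrom (a : ℤ × ℤ → Set ℤ) (x s : ℤ) : Set (ℤ → ℤ) :=
  {π | π ∈ paths a (s : WithBot ℤ) ∧ π s = x}

/-- The backbone at time `t`: the positions at time `t` of the paths started at time `-∞`. -/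
def backbone (a : ℤ × ℤ → Set ℤ) (t : ℤ) : Set ℤ :=
  {y | ∃ π ∈ paths a ⊥, π t = y}

/-- Irreducibility: every point of `ℤ` is reached with positive probability by a path that starts
from the space-time origin. -/
def IsIrreducible {Ω : Type*} [MeasurableSpace Ω] (P : Measure Ω)
    (𝒜 : ℤ × ℤ → Ω → Set ℤ) : Prop :=
  ∀ y : ℤ, 0 < P {ω | ∃ π ∈ pathsFrom (fun z => 𝒜 z ω) 0 0, ∃ n : ℕ, π n = y}

/-- Aperiodicity: the times at which `0` is reached with positive probability by a path that starts
from the space-time origin have greatest common divisor `1`. -/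
def IsAperiodic {Ω : Type*} [MeasurableSpace Ω] (P : Measure Ω)
    (𝒜 : ℤ × ℤ → Ω → Set ℤ) : Prop :=
  Nat.setGcd {n : ℕ | 0 < P {ω | ∃ π ∈ pathsFrom (fun z => 𝒜 z ω) 0 0, π n = 0}} = 1

/-- The intensity `ρ = 1 - ∏ₓ (1 - ψ x)`. -/
def intensity (ψ : ℤ → ℝ) : ℝ := 1 - ∏' x : ℤ, (1 - ψ x)

end BernoulliNet

end

noncomputable section

namespace BernoulliNet

open Filter Topology

/-! Write ρ for the intensity and q = 1 - ρ. Followed backwards in time, the ancestors of a finite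
set form a Markov chain D_n: given D, each x is an ancestor independently with probability h(x)/ρ,
where h = `hitProb ψ D`. Since 1 - (h/ρ)(1 - q) = 1 - h, and the product of 1 - h over all x is
q^|D|, the process q^|D_n| is a martingale (`integral_weight_ancestors`).

Its second moment is at most 1, yet grows at each step by at least ε E[q^(2|D_n|); D_n ≠ ∅] with ε >
0 fixed (`integral_weight_sq_ancestors_ge`). These expectations are therefore summable, and in the
limit the martingale lives on D_n = ∅ (`tendsto_integral_aliveWeight`). So the ancestry of B dies
out with probability q^|B|, the probability that a Bernoulli set misses B; such probabilities
determine the law (`isBernoulliSubset_of_measure_disjoint`).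

A compactness argument identifies the backbone with the sites of infinite ancestry
(`backbone_eq_survivors`). That ε > 0 takes two points in the support of ψ, which irreducibility
supplies (`exists_lt_of_isIrreducible`). -/

/-! ### Avoidance probabilities of Bernoulli sets. -/

lemma isProbabilityMeasure_bernoulliProp {p : ℝ} (hp : p ∈ Set.Icc (0 : ℝ) 1) :
    IsProbabilityMeasure (bernoulliProp p) := by
  constructor
  simp only [bernoulliProp, Measure.add_apply, Measure.smul_apply, measure_univ, smul_eq_mul,
    mul_one]
  rw [← ENNReal.ofReal_add hp.1 (by linarith [hp.2])]
  simp

lemma bernoulliProp_singleton_false (p : ℝ) :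
    bernoulliProp p {False} = ENNReal.ofReal (1 - p) := by
  simp [bernoulliProp]

lemma isProbabilityMeasure_bernoulliSetLaw {α : ℤ → ℝ} (hα : ∀ x, α x ∈ Set.Icc (0 : ℝ) 1) :
    IsProbabilityMeasure (bernoulliSetLaw α) := by
  have := fun x => isProbabilityMeasure_bernoulliProp (hα x)
  exact Measure.isProbabilityMeasure_map measurable_setOfPred.aemeasurable

lemma measurableSet_disjoint (B : Set ℤ) : MeasurableSet {S : Set ℤ | Disjoint S B} := by
  have : {S : Set ℤ | Disjoint S B} = ⋂ x ∈ B, {S : Set ℤ | x ∉ S} := by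
    ext S
    simp [Set.disjoint_right]
  rw [this]
  exact .biInter B.to_countable fun x _ => measurableSet_notMem x

lemma bernoulliSetLaw_disjoint {α : ℤ → ℝ} (hα : ∀ x, α x ∈ Set.Icc (0 : ℝ) 1) (B : Finset ℤ) :
    bernoulliSetLaw α {S | Disjoint S B} = ENNReal.ofReal (∏ x ∈ B, (1 - α x)) := by
  have := fun x => isProbabilityMeasure_bernoulliProp (hα x)
  rw [bernoulliSetLaw, Measure.map_apply measurable_setOfPred (measurableSet_disjoint _)]
  have : (fun v : ℤ → Prop => {x : ℤ | v x}) ⁻¹' {S | Disjoint S (B : Set ℤ)}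
      = Set.pi B (fun _ => {False}) := by
    ext v
    simp [Set.disjoint_right, Set.pi]
  rw [this, Measure.infinitePi_pi _ fun _ _ => .singleton _]
  simp only [bernoulliProp_singleton_false]
  rw [ENNReal.ofReal_prod_of_nonneg fun x _ => by linarith [(hα x).2]]

lemma multipliable_one_sub {ψ : ℤ → ℝ} (hsum : Summable ψ) : Multipliable fun x => 1 - ψ x := by
  simpa [sub_eq_add_neg] using Real.multipliable_one_add_of_summable hsum.neg

lemma hasProd_one_sub {ψ : ℤ → ℝ} (hsum : Summable ψ) :
    HasProd (fun x => 1 - ψ x) (1 - intensity ψ) := by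
  simpa [intensity] using (multipliable_one_sub hsum).hasProd

lemma one_sub_intensity_le_prod {ψ : ℤ → ℝ} (hψ : ∀ x, ψ x ∈ Set.Ico (0 : ℝ) 1)
    (hsum : Summable ψ) (B : Finset ℤ) : 1 - intensity ψ ≤ ∏ x ∈ B, (1 - ψ x) := by
  have h := hasProd_one_sub hsum
  refine le_of_tendsto h ((eventually_ge_atTop B).mono fun F hF => ?_)
  exact Finset.prod_le_prod_of_subset_of_le_one hF (fun x _ => by linarith [(hψ x).2])
    fun x _ _ => by linarith [(hψ x).1]

/-- No factor vanishes because `ψ < 1` everywhere, and summability keeps the infinite product from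
tending to 0. -/
lemma one_sub_intensity_pos {ψ : ℤ → ℝ} (hψ : ∀ x, ψ x ∈ Set.Ico (0 : ℝ) 1)
    (hsum : Summable ψ) : 0 < 1 - intensity ψ := by
  have h0 : 0 ≤ 1 - intensity ψ :=
    ge_of_tendsto' (hasProd_one_sub hsum) fun F =>
      Finset.prod_nonneg fun x _ => by linarith [(hψ x).2]
  refine h0.lt_of_ne' ?_
  have := tprod_one_add_ne_zero_of_summable (R := ℝ) (f := fun x => -ψ x)
    (fun x => by have := (hψ x).2; intro h; linarith) (by simpa using hsum.abs)
  simpa [intensity, sub_eq_add_neg] using this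

lemma intensity_pos {ψ : ℤ → ℝ} (hψ : ∀ x, ψ x ∈ Set.Ico (0 : ℝ) 1)
    (hsum : Summable ψ) {s : ℤ} (hs : 0 < ψ s) : 0 < intensity ψ := by
  have := one_sub_intensity_le_prod hψ hsum {s}
  simp only [Finset.prod_singleton] at this
  linarith

lemma bernoulliSetLaw_ne_empty {ψ : ℤ → ℝ} (hψ : ∀ x, ψ x ∈ Set.Ico (0 : ℝ) 1)
    (hsum : Summable ψ) :
    bernoulliSetLaw ψ {A | A ≠ ∅} = ENNReal.ofReal (intensity ψ) := by
  have hψ' : ∀ x, ψ x ∈ Set.Icc (0 : ℝ) 1 := fun x => ⟨(hψ x).1, (hψ x).2.le⟩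
  have := fun x => isProbabilityMeasure_bernoulliProp (hψ' x)
  have := isProbabilityMeasure_bernoulliSetLaw hψ'
  have h1 : bernoulliSetLaw ψ {∅} = ENNReal.ofReal (1 - intensity ψ) := by
    rw [bernoulliSetLaw, Measure.map_apply measurable_setOfPred (.singleton _)]
    have : (fun v : ℤ → Prop => {x : ℤ | v x}) ⁻¹' {∅} = {fun _ => False} := by
      ext v
      simp [Set.eq_empty_iff_forall_notMem, funext_iff]
    rw [this, Measure.infinitePi_singleton]
    simp only [bernoulliProp_singleton_false]
    refine HasProd.tprod_eq ?_
    refine ((ENNReal.continuous_ofReal.tendsto _).comp (hasProd_one_sub hsum)).congr fun F => ?_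
    exact ENNReal.ofReal_prod_of_nonneg fun x _ => by linarith [(hψ x).2]
  have h2 : {A : Set ℤ | A ≠ ∅} = {∅}ᶜ := rfl
  rw [h2, prob_compl_eq_one_sub (.singleton _), h1, ← ENNReal.ofReal_one,
    ← ENNReal.ofReal_sub _ (one_sub_intensity_pos hψ hsum).le]
  congr 1
  ring

/-! ### Hitting probabilities for one backward step. -/

/-- The set of sites one time step back that have an arrow into `D`, for the arrows `l`. -/
def ancestors (l : ℤ → Set ℤ) (D : Set ℤ) : Set ℤ := {x | ∃ d ∈ D, d - x ∈ l x}

/-- The probability that one of the sites of `D` has an arrow from `x`, for independent arrows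
that are not conditioned to exist. -/
def hitProb (ψ : ℤ → ℝ) (D : Finset ℤ) (x : ℤ) : ℝ := 1 - ∏ d ∈ D, (1 - ψ (d - x))

lemma measurableSet_hit (D : Set ℤ) (x : ℤ) : MeasurableSet {A : Set ℤ | ∃ d ∈ D, d - x ∈ A} := by
  have : {A : Set ℤ | ∃ d ∈ D, d - x ∈ A} = ⋃ d ∈ D, {A : Set ℤ | d - x ∈ A} := by
    ext A
    simp
  rw [this]
  exact .biUnion D.to_countable fun d _ => measurableSet_mem _

lemma offspringLaw_hit {ψ : ℤ → ℝ} (hψ : ∀ x, ψ x ∈ Set.Ico (0 : ℝ) 1) (hsum : Summable ψ)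
    (hρ : 0 < intensity ψ) (D : Finset ℤ) (x : ℤ) :
    offspringLaw ψ {A | ∃ d ∈ D, d - x ∈ A}
      = ENNReal.ofReal (hitProb ψ D x / intensity ψ) := by
  have hψ' : ∀ x, ψ x ∈ Set.Icc (0 : ℝ) 1 := fun x => ⟨(hψ x).1, (hψ x).2.le⟩
  have := isProbabilityMeasure_bernoulliSetLaw hψ'
  have hne : MeasurableSet {A : Set ℤ | A ≠ ∅} := (MeasurableSet.singleton ∅).compl
  have h1 : {A : Set ℤ | A ≠ ∅} ∩ {A | ∃ d ∈ D, d - x ∈ A}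
      = {A | Disjoint A ↑(D.image fun d => d - x)}ᶜ := by
    ext A
    simp only [Set.mem_inter_iff, Set.mem_ofPred_eq, Set.mem_compl_iff, Set.disjoint_right,
      Finset.coe_image, Set.mem_image, forall_exists_index, and_imp, forall_apply_eq_imp_iff₂,
      Finset.mem_coe]
    push Not
    exact ⟨fun h => h.2, fun ⟨d, hd, h⟩ => ⟨⟨_, h⟩, d, hd, h⟩⟩
  rw [offspringLaw, cond_apply hne, h1, prob_compl_eq_one_sub (measurableSet_disjoint _),
    bernoulliSetLaw_disjoint hψ', bernoulliSetLaw_ne_empty hψ hsum,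
    Finset.prod_image (fun a _ b _ h => by simpa using h), ← ENNReal.ofReal_one,
    ← ENNReal.ofReal_sub _ (Finset.prod_nonneg fun d _ => by linarith [(hψ (d - x)).2]),
    ← ENNReal.ofReal_inv_of_pos hρ, ← ENNReal.ofReal_mul (inv_nonneg.2 hρ.le), hitProb]
  congr 1
  ring

lemma hitProb_singleton (ψ : ℤ → ℝ) (d x : ℤ) : hitProb ψ {d} x = ψ (d - x) := by
  simp [hitProb]

lemma hitProb_nonneg {ψ : ℤ → ℝ} (hψ : ∀ x, ψ x ∈ Set.Ico (0 : ℝ) 1) (D : Finset ℤ) (x : ℤ) :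
    0 ≤ hitProb ψ D x :=
  sub_nonneg.2 <| Finset.prod_le_one (fun d _ => by linarith [(hψ (d - x)).2])
    fun d _ => by linarith [(hψ (d - x)).1]

lemma hitProb_le_intensity {ψ : ℤ → ℝ} (hψ : ∀ x, ψ x ∈ Set.Ico (0 : ℝ) 1) (hsum : Summable ψ)
    (D : Finset ℤ) (x : ℤ) : hitProb ψ D x ≤ intensity ψ := by
  have := one_sub_intensity_le_prod hψ hsum (D.image fun d => d - x)
  rw [Finset.prod_image (fun a _ b _ h => by simpa using h)] at this
  rw [hitProb]
  linarith

/-- The product on the right is the gain in second moment at one site; the bound must be uniform in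
`D`. -/
lemma exists_hitProb_mul_ge {ψ : ℤ → ℝ} (hψ : ∀ x, ψ x ∈ Set.Ico (0 : ℝ) 1) (hsum : Summable ψ)
    {s s' : ℤ} (hs : s < s') (D : Finset ℤ) (hD : D.Nonempty) :
    ∃ x, ψ s * ((1 - intensity ψ) * ψ s')
      ≤ hitProb ψ D x * (intensity ψ - hitProb ψ D x) := by
  -- From this site the step `s` lands on the maximum of `D`, while the longer step `s'` overshoots
  -- `D`.
  refine ⟨D.max' hD - s, ?_⟩
  set x := D.max' hD - s with hx
  have hinj : Function.Injective fun d : ℤ => d - x := fun a b h => by simpa using h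
  have h1 : ψ s ≤ hitProb ψ D x := by
    have : ∏ d ∈ D, (1 - ψ (d - x)) ≤ ∏ d ∈ {D.max' hD}, (1 - ψ (d - x)) :=
      Finset.prod_le_prod_of_subset_of_le_one (by simpa using D.max'_mem hD)
        (fun d _ => by linarith [(hψ (d - x)).2]) fun d _ _ => by linarith [(hψ (d - x)).1]
    rw [Finset.prod_singleton, hx, sub_sub_cancel, ← hx] at this
    rw [hitProb]
    linarith
  have hnot : s' ∉ D.image fun d => d - x := by
    simp only [Finset.mem_image, not_exists, not_and]
    intro d hd h
    have := D.le_max' d hd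
    omega
  have h2 := one_sub_intensity_le_prod hψ hsum (insert s' (D.image fun d => d - x))
  rw [Finset.prod_insert hnot, Finset.prod_image hinj.injOn] at h2
  have h3 := one_sub_intensity_le_prod hψ hsum (D.image fun d => d - x)
  rw [Finset.prod_image hinj.injOn] at h3
  have h4 : (1 - intensity ψ) * ψ s' ≤ intensity ψ - hitProb ψ D x := by
    rw [hitProb]
    nlinarith [(hψ s').1]
  exact mul_le_mul h1 h4 (mul_nonneg (one_sub_intensity_pos hψ hsum).le (hψ s').1)
    (hitProb_nonneg hψ D x)

/-- Exchange the products over `x` and over `d ∈ D`: each `d` contributes a reflected copy of the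
product defining the intensity. -/
lemma tendsto_prod_one_sub_hitProb {ψ : ℤ → ℝ} (hsum : Summable ψ) (D : Finset ℤ) :
    Tendsto (fun F : Finset ℤ => ∏ x ∈ F, (1 - hitProb ψ D x)) atTop
      (𝓝 ((1 - intensity ψ) ^ D.card)) := by
  have h : HasProd (fun x => ∏ d ∈ D, (1 - ψ (d - x))) (∏ d ∈ D, (1 - intensity ψ)) :=
    hasProd_prod fun d _ => (Equiv.subLeft d).hasProd_iff.2 (hasProd_one_sub hsum)
  simpa [hitProb, HasProd] using h

/-! ### The exponential weight of a set. -/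

open scoped Classical in
/-- The weight `r ^ |S|` of a set, which is `0` for infinite sets. -/
def weight (r : ℝ) (S : Set ℤ) : ℝ := if S.Finite then r ^ S.ncard else 0

lemma weight_coe (r : ℝ) (D : Finset ℤ) : weight r D = r ^ D.card := by
  simp [weight]

lemma weight_sq (r : ℝ) (S : Set ℤ) : weight (r ^ 2) S = weight r S ^ 2 := by
  by_cases h : S.Finite <;> simp [weight, h, ← pow_mul, mul_comm]

lemma weight_nonneg {r : ℝ} (hr : 0 ≤ r) (S : Set ℤ) : 0 ≤ weight r S := by
  rw [weight]
  split_ifs <;> positivity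

lemma weight_le_one {r : ℝ} (hr : 0 ≤ r) (hr1 : r ≤ 1) (S : Set ℤ) : weight r S ≤ 1 := by
  rw [weight]
  split_ifs
  · exact pow_le_one₀ hr hr1
  · exact zero_le_one

open scoped Classical in
lemma prod_ite_eq_pow (r : ℝ) (S : Set ℤ) (F : Finset ℤ) :
    ∏ x ∈ F, (if x ∈ S then r else 1) = r ^ (F.filter (· ∈ S)).card := by
  rw [Finset.prod_ite]
  simp

open scoped Classical in
lemma tendsto_weight {r : ℝ} (hr : 0 ≤ r) (hr1 : r < 1) (S : Set ℤ) :
    Tendsto (fun F : Finset ℤ => ∏ x ∈ F, (if x ∈ S then r else 1)) atTop (𝓝 (weight r S)) := by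
  simp only [prod_ite_eq_pow]
  by_cases h : S.Finite
  · refine tendsto_nhds_of_eventually_eq ((eventually_ge_atTop h.toFinset).mono fun F hF => ?_)
    rw [weight, if_pos h, Set.ncard_eq_toFinset_card S h]
    congr 2
    ext x
    simp only [Finset.mem_filter, Set.Finite.mem_toFinset, and_iff_right_iff_imp]
    exact fun hx => hF (by simpa using hx)
  · rw [weight, if_neg h]
    refine (tendsto_pow_atTop_nhds_zero_of_lt_one hr hr1).comp (tendsto_atTop.2 fun n => ?_)
    obtain ⟨G, hG, hn⟩ := Set.Infinite.exists_subset_card_eq h n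
    refine (eventually_ge_atTop G).mono fun F hF => ?_
    rw [← hn]
    exact Finset.card_le_card fun x hx => Finset.mem_filter.2 ⟨hF hx, hG hx⟩

lemma measurable_weight {r : ℝ} (hr : 0 ≤ r) (hr1 : r < 1) : Measurable (weight r) := by
  classical
  refine measurable_of_tendsto_metrizable' (atTop : Filter (Finset ℤ))
    (f := fun F S => ∏ x ∈ F, (if x ∈ S then r else 1)) (fun F => ?_)
    (tendsto_pi_nhds.2 fun S => tendsto_weight hr hr1 S)
  exact Finset.measurable_fun_prod _ fun x _ =>
    Measurable.ite (measurableSet_mem x) measurable_const measurable_const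

/-! ### First and second moments of the weight after one backward step. -/

section Layer

variable {Ω : Type*} [MeasurableSpace Ω] {P : Measure Ω} {ψ : ℤ → ℝ} {Y : ℤ → Ω → Set ℤ}

lemma measurable_ancestors : Measurable fun p : Set ℤ × (ℤ → Set ℤ) => ancestors p.2 p.1 := by
  refine measurable_set_iff.2 fun x => ?_
  simp only [ancestors, Set.mem_ofPred_eq]
  refine Measurable.exists fun d => Measurable.and ?_ ?_
  · exact (measurable_set_mem d).comp measurable_fst
  · exact (measurable_set_mem (d - x)).comp ((measurable_pi_apply x).comp measurable_snd)

open scoped Classical in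
lemma integral_prod_ancestors (hψ : ∀ x, ψ x ∈ Set.Ico (0 : ℝ) 1) (hsum : Summable ψ)
    (hρ : 0 < intensity ψ) (hlaw : ∀ x, HasLaw (Y x) (offspringLaw ψ) P) (hind : iIndepFun Y P)
    (D F : Finset ℤ) (r : ℝ) :
    ∫ ω, ∏ x ∈ F, (if x ∈ ancestors (fun x => Y x ω) D then r else 1) ∂P
      = ∏ x ∈ F, (1 - hitProb ψ D x / intensity ψ * (1 - r)) := by
  have := hind.isProbabilityMeasure
  have hf : ∀ x, Measurable fun A : Set ℤ => if ∃ d ∈ (D : Set ℤ), d - x ∈ A then r else 1 :=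
    fun x => Measurable.ite (measurableSet_hit D x) measurable_const measurable_const
  have hY : iIndepFun (fun i : F => Y i) P := hind.precomp Subtype.val_injective
  have h := hY.integral_fun_prod_comp (𝕜 := ℝ) (fun i => (hlaw i).aemeasurable)
    (f := fun (i : F) A => if ∃ d ∈ (D : Set ℤ), d - i ∈ A then r else 1)
    fun i => (hf i).aestronglyMeasurable
  have h1 : ∀ x, ∫ ω, (if ∃ d ∈ (D : Set ℤ), d - x ∈ Y x ω then r else 1) ∂P
      = 1 - hitProb ψ D x / intensity ψ * (1 - r) := by
    intro x
    have h2 : P.real {ω | ∃ d ∈ (D : Set ℤ), d - x ∈ Y x ω} = hitProb ψ D x / intensity ψ := by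
      rw [(hlaw x).measureReal_eq (measurableSet_hit D x), measureReal_def]
      simp only [Finset.mem_coe]
      rw [offspringLaw_hit hψ hsum hρ,
        ENNReal.toReal_ofReal (div_nonneg (hitProb_nonneg hψ D x) hρ.le)]
    have h3 : NullMeasurableSet {ω | ∃ d ∈ (D : Set ℤ), d - x ∈ Y x ω} P :=
      (hlaw x).aemeasurable.nullMeasurableSet_preimage (measurableSet_hit D x)
    have h4 : ∀ ω, (if ∃ d ∈ (D : Set ℤ), d - x ∈ Y x ω then r else 1)
        = 1 - {ω | ∃ d ∈ (D : Set ℤ), d - x ∈ Y x ω}.indicator (fun _ => 1 - r) ω := by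
      intro ω
      simp only [Set.indicator_apply, Set.mem_ofPred_eq]
      split_ifs <;> ring
    simp only [h4]
    rw [integral_sub (integrable_const _) ((integrable_const _).indicator₀ h3),
      integral_indicator₀ h3, setIntegral_const, h2]
    simp
  calc _ = ∫ ω, ∏ i : F, (if ∃ d ∈ (D : Set ℤ), d - i ∈ Y i ω then r else 1) ∂P := by
        refine integral_congr_ae (.of_forall fun ω => ?_)
        beta_reduce
        rw [← Finset.prod_coe_sort F]
        exact Finset.prod_congr rfl fun i _ => if_congr Iff.rfl rfl rfl
    _ = ∏ i : F, (1 - hitProb ψ D i / intensity ψ * (1 - r)) := by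
        rw [h]
        exact Finset.prod_congr rfl fun i _ => h1 i
    _ = _ := Finset.prod_coe_sort F fun x => 1 - hitProb ψ D x / intensity ψ * (1 - r)

lemma aemeasurable_layer (hlaw : ∀ x, HasLaw (Y x) (offspringLaw ψ) P) :
    AEMeasurable (fun ω x => Y x ω) P :=
  aemeasurable_pi_lambda _ fun x => (hlaw x).aemeasurable

lemma tendsto_integral_weight_ancestors (hψ : ∀ x, ψ x ∈ Set.Ico (0 : ℝ) 1) (hsum : Summable ψ)
    (hρ : 0 < intensity ψ) (hlaw : ∀ x, HasLaw (Y x) (offspringLaw ψ) P) (hind : iIndepFun Y P)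
    (D : Finset ℤ) {r : ℝ} (hr : 0 ≤ r) (hr1 : r < 1) :
    Tendsto (fun F : Finset ℤ => ∏ x ∈ F, (1 - hitProb ψ D x / intensity ψ * (1 - r))) atTop
      (𝓝 (∫ ω, weight r (ancestors (fun x => Y x ω) D) ∂P)) := by
  classical
  have := hind.isProbabilityMeasure
  simp only [← integral_prod_ancestors hψ hsum hρ hlaw hind D]
  refine tendsto_integral_filter_of_dominated_convergence (fun _ => 1) (.of_forall fun F => ?_)
    (.of_forall fun F => .of_forall fun ω => ?_) (integrable_const _)
    (.of_forall fun ω => tendsto_weight hr hr1 _)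
  · have : Measurable fun S : Set ℤ => ∏ x ∈ F, (if x ∈ S then r else 1) :=
      Finset.measurable_fun_prod _ fun x _ =>
        Measurable.ite (measurableSet_mem x) measurable_const measurable_const
    exact ((this.comp measurable_ancestors).comp_aemeasurable
      (aemeasurable_const.prodMk (aemeasurable_layer hlaw))).aestronglyMeasurable
  · rw [prod_ite_eq_pow, Real.norm_of_nonneg (by positivity)]
    exact pow_le_one₀ hr hr1.le

lemma integral_weight_ancestors (hψ : ∀ x, ψ x ∈ Set.Ico (0 : ℝ) 1) (hsum : Summable ψ)
    (hρ : 0 < intensity ψ) (hlaw : ∀ x, HasLaw (Y x) (offspringLaw ψ) P) (hind : iIndepFun Y P)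
    (D : Finset ℤ) :
    ∫ ω, weight (1 - intensity ψ) (ancestors (fun x => Y x ω) D) ∂P
      = weight (1 - intensity ψ) D := by
  rw [weight_coe]
  refine tendsto_nhds_unique (tendsto_integral_weight_ancestors hψ hsum hρ hlaw hind D
    (one_sub_intensity_pos hψ hsum).le (by linarith)) ?_
  refine (tendsto_prod_one_sub_hitProb hsum D).congr fun F => Finset.prod_congr rfl fun x _ => ?_
  field_simp
  ring

/-- The squared weight is the weight with base q², so its integral is again a product over sites.
Each factor dominates (1 - h)², and at one well-chosen site the excess is uniform. -/
lemma integral_weight_sq_ancestors_ge (hψ : ∀ x, ψ x ∈ Set.Ico (0 : ℝ) 1) (hsum : Summable ψ)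
    (hρ : 0 < intensity ψ) (hlaw : ∀ x, HasLaw (Y x) (offspringLaw ψ) P) (hind : iIndepFun Y P)
    {s s' : ℤ} (hs : s < s') (D : Finset ℤ) (hD : D.Nonempty) :
    (1 + ψ s * ((1 - intensity ψ) * ψ s')) * weight (1 - intensity ψ) D ^ 2
      ≤ ∫ ω, weight (1 - intensity ψ) (ancestors (fun x => Y x ω) D) ^ 2 ∂P := by
  have hq := one_sub_intensity_pos hψ hsum
  simp only [← weight_sq]
  obtain ⟨x₀, hx₀⟩ := exists_hitProb_mul_ge hψ hsum hs D hD
  set q := 1 - intensity ψ with hqdef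
  set ε := ψ s * (q * ψ s')
  have hε : 0 ≤ ε := mul_nonneg (hψ s).1 (mul_nonneg hq.le (hψ s').1)
  rw [weight_sq, weight_coe]
  refine le_of_tendsto_of_tendsto (((tendsto_prod_one_sub_hitProb hsum D).pow 2).const_mul (1 + ε))
    (tendsto_integral_weight_ancestors hψ hsum hρ hlaw hind D (r := q ^ 2) (by positivity)
      (pow_lt_one₀ hq.le (by linarith) two_ne_zero)) ?_
  refine (eventually_ge_atTop {x₀}).mono fun F hF => ?_
  have hx₀F : x₀ ∈ F := hF (Finset.mem_singleton_self _)
  -- Uses 1 - q² = ρ(1 + q) and q = 1 - ρ; the last term is the gain.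
  have hexp : ∀ x, 1 - hitProb ψ D x / intensity ψ * (1 - q ^ 2)
      = (1 - hitProb ψ D x) ^ 2 + hitProb ψ D x * (intensity ψ - hitProb ψ D x) := by
    intro x
    rw [hqdef]
    field_simp
    ring
  have hnn : ∀ x, 0 ≤ hitProb ψ D x := hitProb_nonneg hψ D
  have hle : ∀ x, hitProb ψ D x ≤ intensity ψ := hitProb_le_intensity hψ hsum D
  beta_reduce
  rw [← Finset.mul_prod_erase F _ hx₀F, ← Finset.mul_prod_erase F _ hx₀F, mul_pow, ← mul_assoc,
    ← Finset.prod_pow]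
  simp only [hexp]
  refine mul_le_mul ?_ (Finset.prod_le_prod (fun x _ => sq_nonneg _) fun x _ => ?_)
    (Finset.prod_nonneg fun x _ => sq_nonneg _) ?_
  · have : (1 - hitProb ψ D x₀) ^ 2 ≤ 1 :=
      pow_le_one₀ (by linarith [hle x₀]) (by linarith [hnn x₀])
    nlinarith
  · nlinarith [mul_nonneg (hnn x) (sub_nonneg.2 (hle x))]
  · nlinarith [mul_nonneg (hnn x₀) (sub_nonneg.2 (hle x₀)), sq_nonneg (1 - hitProb ψ D x₀)]

end Layer

/-! ### The backward chain and its Markov property. -/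

/-- The sites at time `s - n` from which `B` can be reached at time `s` along the arrows of `a`. -/
def ancestry (a : ℤ × ℤ → Set ℤ) (s : ℤ) (B : Set ℤ) : ℕ → Set ℤ
  | 0 => B
  | n + 1 => ancestors (fun x => a (x, s - (n + 1))) (ancestry a s B n)

/-- Every space-time point is the target of finitely many arrows of `a`. -/
def BackwardFinite (a : ℤ × ℤ → Set ℤ) : Prop := ∀ y s, {x | y - x ∈ a (x, s)}.Finite

lemma BackwardFinite.ancestors {a : ℤ × ℤ → Set ℤ} (ha : BackwardFinite a) (s : ℤ) {D : Set ℤ}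
    (hD : D.Finite) : (ancestors (fun x => a (x, s)) D).Finite := by
  refine (hD.biUnion fun d _ => ha d s).subset ?_
  rintro x ⟨d, hd, hx⟩
  exact Set.mem_biUnion hd hx

lemma BackwardFinite.ancestry {a : ℤ × ℤ → Set ℤ} (ha : BackwardFinite a) (s : ℤ) {B : Set ℤ}
    (hB : B.Finite) : ∀ n, (ancestry a s B n).Finite
  | 0 => hB
  | n + 1 => ha.ancestors _ (ha.ancestry s hB n)

lemma measurable_ancestry {Ω : Type*} {m : MeasurableSpace Ω} {a : ℤ × ℤ → Ω → Set ℤ} (s : ℤ)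
    (B : Set ℤ) (n : ℕ) (ha : ∀ z : ℤ × ℤ, s - n ≤ z.2 → Measurable (a z)) :
    Measurable fun ω => ancestry (fun z => a z ω) s B n := by
  induction n with
  | zero => exact measurable_const
  | succ n ih =>
    refine measurable_ancestors.comp ((ih fun z hz => ha z ?_).prodMk
      (measurable_pi_lambda _ fun x => ha _ ?_))
    · push_cast
      linarith
    · push_cast
      exact le_rfl

/-- Fubini for the product law. Taking the inner integral over a second sample ω' of the same space
lets the one-step estimates apply with `X ω` frozen. -/
lemma integral_comp_prodMk_of_indepFun {Ω α β : Type*} [MeasurableSpace Ω] [MeasurableSpace α]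
    [MeasurableSpace β] {P : Measure Ω} [IsProbabilityMeasure P] {X : Ω → α} {Y : Ω → β}
    (hX : Measurable X) (hY : Measurable Y) (hXY : IndepFun X Y P) {g : α × β → ℝ}
    (hg : Measurable g) {C : ℝ} (hC : ∀ p, ‖g p‖ ≤ C) :
    Integrable (fun ω => ∫ ω', g (X ω, Y ω') ∂P) P ∧
      ∫ ω, g (X ω, Y ω) ∂P = ∫ ω, ∫ ω', g (X ω, Y ω') ∂P ∂P := by
  have := Measure.isProbabilityMeasure_map (μ := P) hX.aemeasurable
  have := Measure.isProbabilityMeasure_map (μ := P) hY.aemeasurable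
  have hint : Integrable g ((P.map X).prod (P.map Y)) :=
    .of_bound hg.aestronglyMeasurable C (.of_forall hC)
  have hin : ∀ x, ∫ y, g (x, y) ∂(P.map Y) = ∫ ω', g (x, Y ω') ∂P := fun x =>
    integral_map hY.aemeasurable (hg.comp measurable_prodMk_left).aestronglyMeasurable
  have hl := hint.integral_prod_left
  simp only [hin] at hl
  refine ⟨hl.comp_measurable hX, ?_⟩
  have h1 := integral_map (μ := P) (f := g) (hX.prodMk hY).aemeasurable hg.aestronglyMeasurable
  rw [← h1, hXY.map_prod_eq_prod_map_map hX.aemeasurable hY.aemeasurable, integral_prod _ hint]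
  simp only [hin]
  exact integral_map hX.aemeasurable hl.aestronglyMeasurable

/-! ### The martingale and extinction of the ancestry. -/

section Chain

variable {Ω : Type*} [MeasurableSpace Ω] {P : Measure Ω} {ψ : ℤ → ℝ} {a : ℤ × ℤ → Ω → Set ℤ}

/-- The first `n` backward steps use only arrows leaving from times at least `s - n`, disjoint from
the layer at `s - (n + 1)`. -/
lemma indepFun_ancestry_layer (hm : ∀ z, Measurable (a z)) (hind : iIndepFun a P) (s : ℤ)
    (B : Set ℤ) (n : ℕ) :
    IndepFun (fun ω => ancestry (fun z => a z ω) s B n) (fun ω x => a (x, s - (n + 1)) ω) P := by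
  have hdisj : Disjoint {z : ℤ × ℤ | s - n ≤ z.2} {z : ℤ × ℤ | z.2 = s - (n + 1)} := by
    rw [Set.disjoint_left]
    intro z hz hz'
    simp only [Set.mem_ofPred_eq] at hz hz'
    omega
  have h := indep_iSup_of_disjoint (fun z => (hm z).comap_le) hind.iIndep hdisj
  rw [IndepFun_iff_Indep]
  have key : ∀ (S : Set (ℤ × ℤ)), ∀ z ∈ S,
      Measurable[⨆ i ∈ S, MeasurableSpace.comap (a i) inferInstance] (a z) := fun S z hz =>
    measurable_iff_comap_le.2 (le_iSup₂_of_le z hz le_rfl)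
  have hlayer : ∀ {m : MeasurableSpace Ω}, (∀ x, Measurable[m] (a (x, s - (n + 1)))) →
      Measurable[m] fun ω x => a (x, s - (n + 1)) ω := fun h => measurable_pi_lambda _ h
  refine indep_of_indep_of_le_left (indep_of_indep_of_le_right h ?_) ?_
  · exact (hlayer fun x => key {z | z.2 = s - (n + 1)} (x, s - (n + 1)) rfl).comap_le
  · exact (measurable_ancestry (m := _) s B n fun z hz => key _ z hz).comap_le

lemma integral_ancestry_succ [IsProbabilityMeasure P] (hm : ∀ z, Measurable (a z))
    (hind : iIndepFun a P) (s : ℤ) (B : Set ℤ) (n : ℕ) {f : Set ℤ → ℝ} (hf : Measurable f)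
    {C : ℝ} (hC : ∀ S, ‖f S‖ ≤ C) :
    Integrable (fun ω => ∫ ω', f (ancestors (fun x => a (x, s - (n + 1)) ω')
        (ancestry (fun z => a z ω) s B n)) ∂P) P ∧
      ∫ ω, f (ancestry (fun z => a z ω) s B (n + 1)) ∂P
        = ∫ ω, ∫ ω', f (ancestors (fun x => a (x, s - (n + 1)) ω')
            (ancestry (fun z => a z ω) s B n)) ∂P ∂P :=
  integral_comp_prodMk_of_indepFun (measurable_ancestry s B n fun z _ => hm z)
    (measurable_pi_lambda _ fun _ => hm _) (indepFun_ancestry_layer hm hind s B n)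
    (hf.comp measurable_ancestors) fun _ => hC _

lemma ae_finite_ancestry (hfin : ∀ᵐ ω ∂P, BackwardFinite fun z => a z ω) (s : ℤ)
    (B : Finset ℤ) (n : ℕ) : ∀ᵐ ω ∂P, (ancestry (fun z => a z ω) s B n).Finite := by
  filter_upwards [hfin] with ω hω using hω.ancestry s B.finite_toSet n

/-- The weight of a set that is not empty. -/
def aliveWeight (r : ℝ) (S : Set ℤ) : ℝ := {S : Set ℤ | S ≠ ∅}.indicator (weight r) S

lemma measurable_aliveWeight {r : ℝ} (hr : 0 ≤ r) (hr1 : r < 1) : Measurable (aliveWeight r) :=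
  (measurable_weight hr hr1).indicator (MeasurableSet.singleton ∅).compl

lemma aliveWeight_nonneg {r : ℝ} (hr : 0 ≤ r) (S : Set ℤ) : 0 ≤ aliveWeight r S :=
  Set.indicator_apply_nonneg fun _ => weight_nonneg hr S

lemma aliveWeight_le_one {r : ℝ} (hr : 0 ≤ r) (hr1 : r ≤ 1) (S : Set ℤ) : aliveWeight r S ≤ 1 :=
  Set.indicator_apply_le' (fun _ => weight_le_one hr hr1 S) fun _ => zero_le_one

lemma integrable_comp_of_le_one [IsProbabilityMeasure P] {X : Ω → Set ℤ} (hX : Measurable X)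
    {f : Set ℤ → ℝ} (hf : Measurable f) (h0 : ∀ S, 0 ≤ f S) (h1 : ∀ S, f S ≤ 1) :
    Integrable (fun ω => f (X ω)) P :=
  .of_bound (hf.comp hX).aestronglyMeasurable 1 <| .of_forall fun ω => by
    rw [Real.norm_of_nonneg (h0 _)]
    exact h1 _

variable (hψ : ∀ x, ψ x ∈ Set.Ico (0 : ℝ) 1) (hsum : Summable ψ) (hρ : 0 < intensity ψ)
  (hm : ∀ z, Measurable (a z)) (hlaw : ∀ z, HasLaw (a z) (offspringLaw ψ) P)
  (hind : iIndepFun a P) (hfin : ∀ᵐ ω ∂P, BackwardFinite fun z => a z ω)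

include hψ hsum hρ hm hlaw hind hfin

lemma integral_weight_ancestry (s : ℤ) (B : Finset ℤ) (n : ℕ) :
    ∫ ω, weight (1 - intensity ψ) (ancestry (fun z => a z ω) s B n) ∂P
      = (1 - intensity ψ) ^ B.card := by
  have := hind.isProbabilityMeasure
  have hq := one_sub_intensity_pos hψ hsum
  induction n with
  | zero => simp [ancestry, weight_coe]
  | succ n ih =>
    rw [(integral_ancestry_succ hm hind s B n (measurable_weight hq.le (by linarith)) (C := 1)
      fun S => ?_).2, ← ih]
    · refine integral_congr_ae ?_
      filter_upwards [ae_finite_ancestry hfin s B n] with ω hω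
      rw [← hω.coe_toFinset]
      exact integral_weight_ancestors hψ hsum hρ (fun x => hlaw (x, s - (n + 1)))
        (hind.precomp (g := fun x => (x, s - (n + 1))) fun x y h => congrArg Prod.fst h) _
    · rw [Real.norm_of_nonneg (weight_nonneg hq.le S)]
      exact weight_le_one hq.le (by linarith) S

lemma integral_weight_sq_ancestry_succ_ge {x y : ℤ} (hxy : x < y) (s : ℤ) (B : Finset ℤ) (n : ℕ) :
    ∫ ω, weight (1 - intensity ψ) (ancestry (fun z => a z ω) s B n) ^ 2 ∂P
        + ψ x * ((1 - intensity ψ) * ψ y)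
          * ∫ ω, aliveWeight (1 - intensity ψ) (ancestry (fun z => a z ω) s B n) ^ 2 ∂P
      ≤ ∫ ω, weight (1 - intensity ψ) (ancestry (fun z => a z ω) s B (n + 1)) ^ 2 ∂P := by
  have := hind.isProbabilityMeasure
  have hq := one_sub_intensity_pos hψ hsum
  have hq1 : 1 - intensity ψ < 1 := by linarith
  have hmeas := measurable_ancestry (a := a) s (B : Set ℤ) n fun z _ => hm z
  have hw0 := weight_nonneg hq.le
  have hw1 := weight_le_one hq.le hq1.le
  have hint := integral_ancestry_succ hm hind s B n ((measurable_weight hq.le hq1).pow_const 2)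
    (C := 1) fun S => by
      rw [Real.norm_of_nonneg (sq_nonneg _)]
      exact pow_le_one₀ (hw0 S) (hw1 S)
  have hi1 := integrable_comp_of_le_one (P := P) hmeas ((measurable_weight hq.le hq1).pow_const 2)
    (fun S => sq_nonneg _) fun S => pow_le_one₀ (hw0 S) (hw1 S)
  have hi2 := integrable_comp_of_le_one (P := P) hmeas
    ((measurable_aliveWeight hq.le hq1).pow_const 2)
    (fun S => sq_nonneg _) fun S => pow_le_one₀ (aliveWeight_nonneg hq.le S)
      (aliveWeight_le_one hq.le hq1.le S)
  rw [hint.2, ← integral_const_mul, ← integral_add hi1 (hi2.const_mul _)]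
  refine integral_mono_ae (hi1.add (hi2.const_mul _)) hint.1 ?_
  filter_upwards [ae_finite_ancestry hfin s B n] with ω hω
  rw [← hω.coe_toFinset]
  rcases hω.toFinset.eq_empty_or_nonempty with h | h
  -- The empty set is absorbing: its weight stays 1 and there is no gain.
  · simp [h, aliveWeight, ancestors, weight]
  · have h' : (hω.toFinset : Set ℤ) ≠ ∅ := by simpa using h.ne_empty
    have := integral_weight_sq_ancestors_ge hψ hsum hρ (fun x => hlaw (x, s - (n + 1)))
      (hind.precomp (g := fun x => (x, s - (n + 1))) fun x y h => congrArg Prod.fst h) hxy _ h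
    refine le_trans (le_of_eq ?_) this
    rw [aliveWeight, Set.indicator_of_mem h']
    ring

/-- The second moments telescope and are at most 1, so the gains `ε * e n` are summable and `e n`
tends to 0; Cauchy–Schwarz passes from squares to first moments. -/
lemma tendsto_integral_aliveWeight {x y : ℤ} (hxy : x < y) (hx : 0 < ψ x) (hy : 0 < ψ y) (s : ℤ)
    (B : Finset ℤ) :
    Tendsto (fun n => ∫ ω, aliveWeight (1 - intensity ψ) (ancestry (fun z => a z ω) s B n) ∂P)
      atTop (𝓝 0) := by
  have := hind.isProbabilityMeasure
  have hq := one_sub_intensity_pos hψ hsum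
  have hq1 : 1 - intensity ψ < 1 := by linarith
  have hε : 0 < ψ x * ((1 - intensity ψ) * ψ y) := by positivity
  set q := 1 - intensity ψ
  set ε := ψ x * (q * ψ y)
  set v : ℕ → ℝ := fun n => ∫ ω, weight q (ancestry (fun z => a z ω) s B n) ^ 2 ∂P
  set e : ℕ → ℝ := fun n => ∫ ω, aliveWeight q (ancestry (fun z => a z ω) s B n) ^ 2 ∂P
  have hmeas : ∀ n, Measurable fun ω => ancestry (fun z => a z ω) s (B : Set ℤ) n :=
    fun n => measurable_ancestry s (B : Set ℤ) n fun z _ => hm z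
  have hstep : ∀ n, v n + ε * e n ≤ v (n + 1) := fun n =>
    integral_weight_sq_ancestry_succ_ge hψ hsum hρ hm hlaw hind hfin hxy s B n
  have he0 : ∀ n, 0 ≤ e n := fun n => integral_nonneg fun ω => sq_nonneg _
  have hv0 : 0 ≤ v 0 := integral_nonneg fun ω => sq_nonneg _
  have hv1 : ∀ n, v n ≤ 1 := fun n => by
    have := integral_mono (integrable_comp_of_le_one (P := P) (hmeas n)
      ((measurable_weight hq.le hq1).pow_const 2) (fun S => sq_nonneg _)
      fun S => pow_le_one₀ (weight_nonneg hq.le S) (weight_le_one hq.le hq1.le S))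
      (integrable_const 1)
      fun ω => pow_le_one₀ (weight_nonneg hq.le _) (weight_le_one hq.le hq1.le _)
    simpa using this
  have hsumle : ∀ n, ε * ∑ i ∈ Finset.range n, e i ≤ v n := by
    intro n
    induction n with
    | zero => simpa using hv0
    | succ n ih =>
      rw [Finset.sum_range_succ, mul_add]
      linarith [hstep n]
  have hsumm : Summable e := summable_of_sum_range_le (c := 1 / ε) he0 fun n => by
    rw [le_div_iff₀ hε, mul_comm]
    exact (hsumle n).trans (hv1 n)
  have hsqrt : Tendsto (fun n => √(e n)) atTop (𝓝 0) := by
    simpa using hsumm.tendsto_atTop_zero.sqrt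
  refine squeeze_zero (fun n => integral_nonneg fun ω => aliveWeight_nonneg hq.le _)
    (fun n => Real.le_sqrt_of_sq_le ?_) hsqrt
  have hmem : MemLp (fun ω => aliveWeight q (ancestry (fun z => a z ω) s B n)) 2 P :=
    MemLp.of_bound ((measurable_aliveWeight hq.le hq1).comp (hmeas n)).aestronglyMeasurable 1
      (.of_forall fun ω => by
        rw [Real.norm_of_nonneg (aliveWeight_nonneg hq.le _)]
        exact aliveWeight_le_one hq.le hq1.le _)
  have hvar := variance_nonneg (fun ω => aliveWeight q (ancestry (fun z => a z ω) s B n)) P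
  rw [variance_eq_sub hmem] at hvar
  exact sub_nonneg.1 hvar

/-- The constant expectation of the weight splits into the extinction probability, as the empty set
has weight 1, and the alive part, which vanishes in the limit. -/
lemma tendsto_measureReal_ancestry_eq_empty {x y : ℤ} (hxy : x < y) (hx : 0 < ψ x) (hy : 0 < ψ y)
    (s : ℤ) (B : Finset ℤ) :
    Tendsto (fun n => P.real {ω | ancestry (fun z => a z ω) s B n = ∅}) atTop
      (𝓝 ((1 - intensity ψ) ^ B.card)) := by
  have := hind.isProbabilityMeasure
  have hq := one_sub_intensity_pos hψ hsum
  have hq1 : 1 - intensity ψ < 1 := by linarith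
  have h := (tendsto_integral_aliveWeight hψ hsum hρ hm hlaw hind hfin hxy hx hy s B).const_sub
    ((1 - intensity ψ) ^ B.card)
  rw [sub_zero] at h
  refine h.congr fun n => ?_
  have hmeas : Measurable fun ω => ancestry (fun z => a z ω) s (B : Set ℤ) n :=
    measurable_ancestry s (B : Set ℤ) n fun z _ => hm z
  have hE : MeasurableSet {ω | ancestry (fun z => a z ω) s (B : Set ℤ) n = ∅} :=
    hmeas (.singleton ∅)
  rw [sub_eq_iff_eq_add, ← integral_weight_ancestry hψ hsum hρ hm hlaw hind hfin s B n,
    ← integral_indicator_one hE, ← integral_add]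
  · refine integral_congr_ae (.of_forall fun ω => ?_)
    by_cases h : ancestry (fun z => a z ω) s (B : Set ℤ) n = ∅
    · simp [h, aliveWeight, weight]
    · simp [h, aliveWeight]
  · exact (integrable_const 1).indicator hE
  · exact integrable_comp_of_le_one hmeas (measurable_aliveWeight hq.le hq1)
      (aliveWeight_nonneg hq.le) (aliveWeight_le_one hq.le hq1.le)

end Chain

/-! ### The backbone as the set of sites with infinite ancestry. -/

section Deterministic

variable {a : ℤ × ℤ → Set ℤ}

/-- The recursion adds the earliest step last; building a backward path requires peeling off the
step nearest to `s` instead. -/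
lemma ancestry_succ_eq (a : ℤ × ℤ → Set ℤ) (s : ℤ) (B : Set ℤ) (n : ℕ) :
    ancestry a s B (n + 1) = ancestry a (s - 1) (ancestors (fun x => a (x, s - 1)) B) n := by
  induction n with
  | zero => simp [ancestry]
  | succ n ih =>
    rw [ancestry, ih, ancestry]
    congr 1
    funext x
    congr 2
    push_cast
    ring

lemma mem_ancestry_iff (s : ℤ) (B : Set ℤ) (n : ℕ) (x : ℤ) :
    x ∈ ancestry a s B n ↔ ∃ y ∈ B, x ∈ ancestry a s {y} n := by
  induction n generalizing x with
  | zero => simp [ancestry]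
  | succ n ih =>
    simp only [ancestry, ancestors, Set.mem_ofPred_eq]
    constructor
    · rintro ⟨d, hd, hx⟩
      obtain ⟨y, hy, hdy⟩ := (ih d).1 hd
      exact ⟨y, hy, d, hdy, hx⟩
    · rintro ⟨y, hy, d, hdy, hx⟩
      exact ⟨d, (ih d).2 ⟨y, hy, hdy⟩, hx⟩

lemma ancestry_eq_empty_of_le {s : ℤ} {B : Set ℤ} {n m : ℕ} (hnm : n ≤ m)
    (h : ancestry a s B n = ∅) : ancestry a s B m = ∅ := by
  induction m, hnm using Nat.le_induction with
  | base => exact h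
  | succ m _ ih => simp [ancestry, ancestors, ih]

/-- The sites at time `s` that have ancestors at all earlier times. -/
def survivors (a : ℤ × ℤ → Set ℤ) (s : ℤ) : Set ℤ := {y | ∀ n, ancestry a s {y} n ≠ ∅}

lemma disjoint_survivors_iff (s : ℤ) (B : Finset ℤ) :
    Disjoint (survivors a s) B ↔ ∃ n, ancestry a s B n = ∅ := by
  rw [Set.disjoint_right]
  constructor
  · intro h
    have h' : ∀ y, ∃ n, y ∈ B → ancestry a s {y} n = ∅ := by
      intro y
      by_cases hy : y ∈ B
      · have := h (Finset.mem_coe.2 hy)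
        simp only [survivors, Set.mem_ofPred_eq, not_forall, not_not] at this
        exact this.imp fun n hn _ => hn
      · exact ⟨0, fun h => absurd h hy⟩
    choose n hn using h'
    -- Extinction is permanent, so the latest of the extinction times serves all of `B`.
    refine ⟨B.sup n, Set.eq_empty_of_forall_notMem fun x hx => ?_⟩
    obtain ⟨y, hy, hxy⟩ := (mem_ancestry_iff s B _ x).1 hx
    rw [ancestry_eq_empty_of_le (Finset.le_sup hy) (hn y hy)] at hxy
    exact hxy
  · rintro ⟨n, hn⟩ y hy hys
    refine hys n (Set.eq_empty_of_forall_notMem fun x hx => ?_)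
    have := (mem_ancestry_iff s B n x).2 ⟨y, hy, hx⟩
    rw [hn] at this
    exact this

/-- The step of König's lemma: if all of the finitely many predecessors died out, they would have a
common extinction time, and `y` would be extinct one step later. -/
lemma exists_arrow_of_mem_survivors (ha : BackwardFinite a) {s y : ℤ} (hy : y ∈ survivors a s) :
    ∃ x, y - x ∈ a (x, s - 1) ∧ x ∈ survivors a (s - 1) := by
  have hfin := ha.ancestors (s - 1) (Set.finite_singleton y)
  have h : ¬ Disjoint (survivors a (s - 1)) hfin.toFinset := by
    rw [disjoint_survivors_iff]
    rintro ⟨n, hn⟩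
    rw [hfin.coe_toFinset, ← ancestry_succ_eq] at hn
    exact hy _ hn
  obtain ⟨x, hx, hxy⟩ := Set.not_disjoint_iff.1 h
  rw [hfin.coe_toFinset] at hxy
  obtain ⟨d, rfl, hd⟩ := hxy
  exact ⟨x, hd, hx⟩

lemma exists_backward_of_mem_survivors (ha : BackwardFinite a) {t y : ℤ}
    (hy : y ∈ survivors a t) :
    ∃ b : ℕ → ℤ, b 0 = y ∧ ∀ n : ℕ, b n - b (n + 1) ∈ a (b (n + 1), t - (n + 1)) := by
  have h : ∀ s y, ∃ x, y ∈ survivors a s → y - x ∈ a (x, s - 1) ∧ x ∈ survivors a (s - 1) := by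
    intro s y
    by_cases hy : y ∈ survivors a s
    · exact (exists_arrow_of_mem_survivors ha hy).imp fun x hx _ => hx
    · exact ⟨0, fun h => absurd h hy⟩
  choose g hg using h
  let b : ℕ → ℤ := fun n => Nat.rec y (fun n x => g (t - n) x) n
  have hb : ∀ n : ℕ, b n ∈ survivors a (t - n) := by
    intro n
    induction n with
    | zero => simpa [b] using hy
    | succ n ih =>
      have := (hg (t - n) (b n) ih).2
      rw [sub_sub] at this
      exact_mod_cast this
  refine ⟨b, rfl, fun n => ?_⟩
  have := (hg (t - n) (b n) (hb n)).1
  rwa [sub_sub] at this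

lemma exists_forward (hne : ∀ z, (a z).Nonempty) (t y : ℤ) :
    ∃ f : ℕ → ℤ, f 0 = y ∧ ∀ n : ℕ, f (n + 1) - f n ∈ a (f n, t + n) := by
  choose g hg using hne
  refine ⟨fun n => Nat.rec y (fun n x => x + g (x, t + n)) n, rfl, fun n => ?_⟩
  simpa using hg _

lemma backbone_eq_survivors (hne : ∀ z, (a z).Nonempty) (ha : BackwardFinite a) (t : ℤ) :
    backbone a t = survivors a t := by
  ext y
  constructor
  · rintro ⟨π, hπ, rfl⟩ n
    have : ∀ n : ℕ, π (t - n) ∈ ancestry a t {π t} n := by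
      intro n
      induction n with
      | zero => simp [ancestry]
      | succ n ih =>
        refine ⟨_, ih, ?_⟩
        have := hπ (t - (n + 1)) bot_le
        rw [show t - ((n : ℤ) + 1) + 1 = t - n by ring] at this
        exact_mod_cast this
    exact (Set.nonempty_of_mem (this n)).ne_empty
  · intro hy
    obtain ⟨b, hb0, hb⟩ := exists_backward_of_mem_survivors ha hy
    obtain ⟨f, hf0, hf⟩ := exists_forward hne t y
    -- The backward and forward paths are glued at time `t`, where both are at `y`.
    refine ⟨fun u => if u ≤ t then b (t - u).toNat else f (u - t).toNat, fun u _ => ?_, by simp [hb0]⟩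
    beta_reduce
    rcases lt_or_ge u t with hu | hu
    · obtain ⟨n, rfl⟩ : ∃ n : ℕ, u = t - (n + 1) := ⟨(t - u - 1).toNat, by omega⟩
      have := hb n
      rw [if_pos (by omega), if_pos (by omega),
        show (t - (t - ((n : ℤ) + 1) + 1)).toNat = n by omega,
        show (t - (t - ((n : ℤ) + 1))).toNat = n + 1 by omega]
      exact this
    · obtain ⟨n, rfl⟩ : ∃ n : ℕ, u = t + n := ⟨(u - t).toNat, by omega⟩
      have h1 : (if t + (n : ℤ) ≤ t then b (t - (t + n)).toNat else f (t + n - t).toNat) = f n := by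
        split_ifs with h
        · obtain rfl : n = 0 := by omega
          simp [hb0, hf0]
        · simp
      rw [h1, if_neg (by omega), show (t + (n : ℤ) + 1 - t).toNat = n + 1 by omega]
      exact hf n

end Deterministic

/-! ### Avoidance probabilities determine the law of a random set. -/

lemma generateFrom_disjoint_finset :
    (inferInstance : MeasurableSpace (Set ℤ))
      = MeasurableSpace.generateFrom {E | ∃ B : Finset ℤ, E = {S : Set ℤ | Disjoint S B}} := by
  refine le_antisymm ?_ (MeasurableSpace.generateFrom_le ?_)
  · have h : Measurable[MeasurableSpace.generateFrom
        {E | ∃ B : Finset ℤ, E = {S : Set ℤ | Disjoint S B}}] (id : Set ℤ → Set ℤ) := by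
      refine (@measurable_set_iff _ _ (_) _).2 fun x => ?_
      refine (@measurableSet_setOfPred _ (_) _).1 ?_
      have : {S : Set ℤ | x ∈ id S} = {S : Set ℤ | Disjoint S ↑({x} : Finset ℤ)}ᶜ := by
        ext S
        simp
      rw [this]
      refine MeasurableSet.compl (m := _) ?_
      exact MeasurableSpace.measurableSet_generateFrom ⟨{x}, rfl⟩
    simpa using h.comap_le
  · rintro _ ⟨B, rfl⟩
    exact measurableSet_disjoint B

lemma isPiSystem_disjoint_finset :
    IsPiSystem {E | ∃ B : Finset ℤ, E = {S : Set ℤ | Disjoint S B}} := by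
  rintro _ ⟨B, rfl⟩ _ ⟨B', rfl⟩ _
  refine ⟨B ∪ B', ?_⟩
  ext S
  simp

lemma isBernoulliSubset_of_measure_disjoint {Ω : Type*} [MeasurableSpace Ω] {P : Measure Ω}
    [IsProbabilityMeasure P] {Λ : Ω → Set ℤ} (hΛ : Measurable Λ) {α : ℤ → ℝ}
    (hα : ∀ x, α x ∈ Set.Icc (0 : ℝ) 1)
    (h : ∀ B : Finset ℤ, P {ω | Disjoint (Λ ω) B} = ENNReal.ofReal (∏ x ∈ B, (1 - α x))) :
    IsBernoulliSubset P Λ α := by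
  have := isProbabilityMeasure_bernoulliSetLaw hα
  have := Measure.isProbabilityMeasure_map (μ := P) hΛ.aemeasurable
  refine ⟨hΛ.aemeasurable, ext_of_generate_finite _ generateFrom_disjoint_finset
    isPiSystem_disjoint_finset ?_ (by simp)⟩
  rintro _ ⟨B, rfl⟩
  rw [Measure.map_apply hΛ (measurableSet_disjoint _), bernoulliSetLaw_disjoint hα]
  exact h B

/-! ### Consequences for the net. -/

section Net

variable {Ω : Type*} [MeasurableSpace Ω] {P : Measure Ω} {ψ : ℤ → ℝ} {a : ℤ × ℤ → Ω → Set ℤ}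

/-- Borel–Cantelli: the expected number of arrows into a given point is a rescaled sum of `ψ`. -/
lemma ae_backwardFinite (hψ : ∀ x, ψ x ∈ Set.Ico (0 : ℝ) 1) (hsum : Summable ψ)
    (hρ : 0 < intensity ψ) (hlaw : ∀ z, HasLaw (a z) (offspringLaw ψ) P) :
    ∀ᵐ ω ∂P, BackwardFinite fun z => a z ω := by
  refine ae_all_iff.2 fun y => ae_all_iff.2 fun s => ?_
  refine ae_finite_setOfPred_mem (s := fun x => {ω | y - x ∈ a (x, s) ω}) ?_
  have h : ∀ x, P {ω | y - x ∈ a (x, s) ω} = ENNReal.ofReal (ψ (y - x) / intensity ψ) := by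
    intro x
    rw [(hlaw (x, s)).measure_eq (measurableSet_mem (y - x)), ← hitProb_singleton ψ y x,
      ← offspringLaw_hit hψ hsum hρ]
    simp
  simp only [h]
  exact (((Equiv.subLeft y).summable_iff.2 hsum).div_const _).tsum_ofReal_ne_top

/-- If `ψ` lived on at most one point `s`, almost surely every step would equal `s`, and only
natural multiples of `s` could be reached. -/
lemma exists_lt_of_isIrreducible (hψ : ∀ x, ψ x ∈ Set.Ico (0 : ℝ) 1)
    (hlaw : ∀ z, HasLaw (a z) (offspringLaw ψ) P) (hirr : IsIrreducible P a) :
    ∃ x y, x < y ∧ 0 < ψ x ∧ 0 < ψ y := by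
  by_contra! hcon
  obtain ⟨s, hs⟩ : ∃ s, ∀ x, x ≠ s → ψ x = 0 := by
    by_cases h : ∃ s, 0 < ψ s
    · obtain ⟨s, hs⟩ := h
      refine ⟨s, fun x hx => le_antisymm ?_ (hψ x).1⟩
      rcases lt_or_gt_of_ne hx with hx | hx
      · by_contra! h0
        exact absurd (hcon x s hx h0) (not_le.2 hs)
      · exact hcon s x hx hs
    · push Not at h
      exact ⟨0, fun x _ => le_antisymm (h x) (hψ x).1⟩
  have hψ' : ∀ x, ψ x ∈ Set.Icc (0 : ℝ) 1 := fun x => ⟨(hψ x).1, (hψ x).2.le⟩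
  have := isProbabilityMeasure_bernoulliSetLaw hψ'
  have hae : ∀ᵐ ω ∂P, ∀ z, ∀ x, x ≠ s → x ∉ a z ω := by
    refine ae_all_iff.2 fun z => ae_all_iff.2 fun x => ?_
    by_cases hx : x = s
    · simp [hx]
    · have h0 : bernoulliSetLaw ψ {A | x ∈ A} = 0 := by
        have : {A : Set ℤ | x ∈ A} = {A | Disjoint A ↑({x} : Finset ℤ)}ᶜ := by
          ext A
          simp
        rw [this, prob_compl_eq_one_sub (measurableSet_disjoint _),
          bernoulliSetLaw_disjoint hψ']
        simp [hs x hx]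
      have h1 : P {ω | x ∈ a z ω} = 0 := by
        rw [(hlaw z).measure_eq (measurableSet_mem x)]
        exact cond_absolutelyContinuous h0
      filter_upwards [measure_eq_zero_iff_ae_notMem.1 h1] with ω hω _ using hω
  have hreach : ∀ y, ∃ n : ℕ, (n : ℤ) * s = y := by
    intro y
    obtain ⟨ω, ⟨π, ⟨hπ, hπ0⟩, n, hn⟩, hω⟩ : ∃ ω,
        (∃ π ∈ pathsFrom (fun z => a z ω) 0 0, ∃ n : ℕ, π n = y)
          ∧ ∀ z, ∀ x, x ≠ s → x ∉ a z ω :=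
      ((frequently_ae_iff.2 (hirr y).ne').and_eventually hae).exists
    refine ⟨n, ?_⟩
    rw [← hn]
    have : ∀ n : ℕ, π n = n * s := by
      intro n
      induction n with
      | zero => simpa using hπ0
      | succ n ih =>
        have h := hπ n (by exact_mod_cast Int.natCast_nonneg n)
        have h' : π (n + 1) - π n = s := by
          by_contra hne
          exact hω _ _ hne h
        push_cast
        linarith
    exact (this n).symm
  -- Natural multiples of one integer cannot include both 1 and -1.
  obtain ⟨n, hn⟩ := hreach 1
  obtain ⟨m, hm⟩ := hreach (-1)
  rcases le_or_gt s 0 with h | h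
  · nlinarith [Int.natCast_nonneg n]
  · nlinarith [Int.natCast_nonneg m]

lemma measurable_survivors (hm : ∀ z, Measurable (a z)) (t : ℤ) :
    Measurable fun ω => survivors (fun z => a z ω) t := by
  refine measurable_set_iff.2 fun y => Measurable.forall fun n => ?_
  exact measurableSet_setOfPred.1
    (measurable_ancestry t {y} n (fun z _ => hm z) (MeasurableSet.singleton ∅)).compl

lemma isBernoulliSubset_survivors (hψ : ∀ x, ψ x ∈ Set.Ico (0 : ℝ) 1) (hsum : Summable ψ)
    {x y : ℤ} (hxy : x < y) (hx : 0 < ψ x) (hy : 0 < ψ y) (hm : ∀ z, Measurable (a z))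
    (hlaw : ∀ z, HasLaw (a z) (offspringLaw ψ) P) (hind : iIndepFun a P) (t : ℤ) :
    IsBernoulliSubset P (fun ω => survivors (fun z => a z ω) t) (fun _ => intensity ψ) := by
  have := hind.isProbabilityMeasure
  have hρ := intensity_pos hψ hsum hx
  have hq := one_sub_intensity_pos hψ hsum
  refine isBernoulliSubset_of_measure_disjoint (measurable_survivors hm t)
    (fun _ => ⟨hρ.le, by linarith⟩) fun B => ?_
  have hlim := tendsto_measureReal_ancestry_eq_empty hψ hsum hρ hm hlaw hind
    (ae_backwardFinite hψ hsum hρ hlaw) hxy hx hy t B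
  have hE : {ω | Disjoint (survivors (fun z => a z ω) t) (B : Set ℤ)}
      = ⋃ n, {ω | ancestry (fun z => a z ω) t (B : Set ℤ) n = ∅} := by
    ext ω
    simp [disjoint_survivors_iff]
  have hmono : Monotone fun n => {ω | ancestry (fun z => a z ω) t (B : Set ℤ) n = ∅} :=
    fun n m hnm ω hω => ancestry_eq_empty_of_le hnm hω
  rw [hE]
  refine tendsto_nhds_unique (tendsto_measure_iUnion_atTop hmono) ?_
  simp only [Finset.prod_const]
  refine (ENNReal.tendsto_ofReal hlim).congr fun n => ?_
  exact ofReal_measureReal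

end Net

end BernoulliNet

end

theorem proposition4 {Ω : Type*} [MeasurableSpace Ω] (P : Measure Ω) [IsProbabilityMeasure P]
    (ψ : ℤ → ℝ) (hψ : ∀ x, ψ x ∈ Set.Ico (0 : ℝ) 1) (hsum : Summable ψ)
    (𝒜 : ℤ × ℤ → Ω → Set ℤ) (hnet : BernoulliNet.IsBernoulliNet P ψ 𝒜)
    (hirr : BernoulliNet.IsIrreducible P 𝒜) (haper : BernoulliNet.IsAperiodic P 𝒜) (t : ℤ) :
    BernoulliNet.IsBernoulliSubset P (fun ω => BernoulliNet.backbone (fun z => 𝒜 z ω) t)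
      (fun _ => BernoulliNet.intensity ψ) := by
  obtain ⟨x, y, hxy, hx, hy⟩ :=
    BernoulliNet.exists_lt_of_isIrreducible hψ hnet.hasLaw hirr
  -- The arrows are only a.e. measurable, so the law is computed for measurable versions and carried
  -- back along an a.e. equality valid for all countably many `z` at once.
  have hae : ∀ z, 𝒜 z =ᵐ[P] (hnet.hasLaw z).aemeasurable.mk (𝒜 z) := fun z =>
    (hnet.hasLaw z).aemeasurable.ae_eq_mk
  refine (BernoulliNet.isBernoulliSubset_survivors hψ hsum hxy hx hy
    (fun z => (hnet.hasLaw z).aemeasurable.measurable_mk)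
    (fun z => (hnet.hasLaw z).congr (hae z).symm) (hnet.indep.congr hae) t).congr ?_
  filter_upwards [ae_all_iff.2 hae, BernoulliNet.ae_backwardFinite hψ hsum
    (BernoulliNet.intensity_pos hψ hsum hx) hnet.hasLaw] with ω hω hfin
  rw [BernoulliNet.backbone_eq_survivors (fun z => hnet.nonempty z ω) hfin]
  congr 1
  funext z
  exact hω z
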